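/- Let $H_1,\dots,H_k$ be linear subspaces of $\mathbb{R}^n$ with $1\le \dim H_j\le n-2$ for $j=1,\dots,k$. Let $S^{n-1}$ be the unit sphere in $\mathbb{R}^n$ and $o$ the origin. The following four statements are equivalent. (i) $H_1^{\perp}+\cdots+H_k^{\perp}=\mathbb{R}^n$, and the set $\{H_1^{\perp},\dots,H_k^{\perp}\}$ cannot be partitioned into two nonempty subsets such that every subspace in the first is orthogonal to every subspace in the second. (ii) If $E\subset S^{n-1}$ is nonempty and closed, and $S^{n-1}\cap(H_j^{\perp}+x)\subset E$ for every $j=1,\dots,k$ and every $x\in E$, then $E=S^{n-1}$. (iii) If $F\subset\mathbb{R}^n$ is closed and, for every $j=1,\dots,k$, $\phi F=F$ for every rotation $\phi\in SO(n)$ that fixes every point of $H_j$, then $F$ is a (possibly empty) union of spheres centered at $o$, where a sphere may have radius $0$. (iv) If $K\subset\mathbb{R}^n$ is a convex body (a compact convex set with nonempty interior) that is rotationally symmetric with respect to $H_j$ for every $j=1,\dots,k$, then $K$ is a closed ball of positive radius centered at $o$. Here a set $X\subset\mathbb{R}^n$ is called rotationally symmetric with respect to a subspace $H$ if, for every $x\in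 H$, the set $X\cap(H^{\perp}+x)$ is a (possibly empty) union of spheres in the affine subspace $H^{\perp}+x$ centered at $x$, where a sphere may have radius $0$. -/

import Mathlib

/-- The linear isometry `φ` of `ℝⁿ` is a rotation that fixes `H`, that is, an element of the
pointwise stabilizer `SO(n)_H`: it has determinant one and acts as the identity on `H`. -/
def IsRotationFixing {n : ℕ} (H : Submodule ℝ (EuclideanSpace ℝ (Fin n)))
    (φ : EuclideanSpace ℝ (Fin n) ≃ₗᵢ[ℝ] EuclideanSpace ℝ (Fin n)) : Prop :=
  LinearMap.det (φ.toLinearEquiv : EuclideanSpace ℝ (Fin n) →ₗ[ℝ] EuclideanSpace ℝ (Fin n)) = 1 ∧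
    ∀ x ∈ H, φ x = x

/-- The affine subspace `Hᗮ + x`, as a set. -/
def perpTranslate {n : ℕ} (H : Submodule ℝ (EuclideanSpace ℝ (Fin n)))
    (x : EuclideanSpace ℝ (Fin n)) : Set (EuclideanSpace ℝ (Fin n)) :=
  {y | y - x ∈ Hᗮ}

/-- `X` is rotationally symmetric with respect to `H`: for every `x ∈ H` the section
`X ∩ (Hᗮ + x)` is a union of spheres of the affine subspace `Hᗮ + x` centered at `x`.
A sphere may have radius zero, and the union may be empty. -/
def IsRotationallySymmetric {n : ℕ} (H : Submodule ℝ (EuclideanSpace ℝ (Fin n)))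
    (X : Set (EuclideanSpace ℝ (Fin n))) : Prop :=
  ∀ x ∈ H, ∃ R : Set ℝ, (∀ r ∈ R, 0 ≤ r) ∧
    X ∩ perpTranslate H x = ⋃ r ∈ R, Metric.sphere x r ∩ perpTranslate H x

/-- The set `𝒰` of subspaces can be partitioned into two nonempty subsets such that each subspace
in the first is orthogonal to each subspace in the second. -/
def HasOrthogonalPartition {n : ℕ} (𝒰 : Set (Submodule ℝ (EuclideanSpace ℝ (Fin n)))) : Prop :=
  ∃ 𝒜 ℬ : Set (Submodule ℝ (EuclideanSpace ℝ (Fin n))), 𝒜.Nonempty ∧ ℬ.Nonempty ∧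
    Disjoint 𝒜 ℬ ∧ 𝒜 ∪ ℬ = 𝒰 ∧ ∀ U ∈ 𝒜, ∀ V ∈ ℬ, U ⟂ V

/-! All four conditions concern sets invariant under moves: passing from `x` to a point of the same
norm that differs from `x` by a vector of `(H j)ᗮ`. A move along a line is the identity or a
reflection, so the directions `w` whose line moves preserve `A` are closed under scaling and under
each other's reflections.

The core is `sup_span_singleton_subset_of_reflection`: if these directions contain a subspace `W`
with `dim W ≥ 2` and a vector `v` not orthogonal to `W`, they contain `W + ℝ v`. For a maximal such
`W`, every `(H j)ᗮ` therefore lies in `W` or in `Wᗮ`. Under (i) this forces `W = ⊤`, so `A` is a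
union of spheres; this gives (ii), (iii) and (iv).

If (i) fails, some convex function is constant along moves but not on the unit sphere: a linear
functional vanishing on all `(H j)ᗮ`, or the norm of the projection to one half of an orthogonal
splitting. Its sublevel sets in the sphere contradict (ii) and (iii), those in the ball (iv). -/

open Metric Submodule

/-! ### Moves and reflections -/

section Moves

variable {V : Type*} [NormedAddCommGroup V] [InnerProductSpace ℝ V]

/-- A set is invariant under moves in the direction of `U` if it contains, with each point `x`, all
points of `x + U` of the same norm as `x`. -/
def MoveInvariant (U : Submodule ℝ V) (A : Set V) : Prop :=
  ∀ x ∈ A, ∀ y, y - x ∈ U → ‖y‖ = ‖x‖ → y ∈ A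

theorem MoveInvariant.mono {U W : Submodule ℝ V} {A : Set V} (h : MoveInvariant W A)
    (hUW : U ≤ W) : MoveInvariant U A :=
  fun x hx y hy hn => h x hx y (hUW hy) hn

theorem moveInvariant_of_span_singleton {U : Submodule ℝ V} {A : Set V}
    (h : ∀ w ∈ U, MoveInvariant (ℝ ∙ w) A) : MoveInvariant U A :=
  fun x hx y hy hn => h _ hy x hx y (mem_span_singleton_self _) hn

theorem reflection_sub_self_mem_span (w x : V) :
    (ℝ ∙ w)ᗮ.reflection x - x ∈ ℝ ∙ w := by
  have h := ((ℝ ∙ w)ᗮ).sub_starProjection_mem_orthogonal x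
  rw [Submodule.orthogonal_orthogonal] at h
  rw [Submodule.reflection_apply]
  have : (2 • (ℝ ∙ w)ᗮ.starProjection x - x) - x = (-2 : ℝ) • (x - (ℝ ∙ w)ᗮ.starProjection x) := by
    module
  rw [this]
  exact Submodule.smul_mem _ _ h

theorem MoveInvariant.reflection_mem {w : V} {A : Set V} (h : MoveInvariant (ℝ ∙ w) A) {x : V}
    (hx : x ∈ A) : (ℝ ∙ w)ᗮ.reflection x ∈ A :=
  h x hx _ (reflection_sub_self_mem_span w x) (LinearIsometryEquiv.norm_map _ _)

/-- Conjugation: reflect by `w`, move along `w'`, reflect back. -/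
theorem MoveInvariant.span_reflection {w w' : V} {A : Set V} (h : MoveInvariant (ℝ ∙ w) A)
    (h' : MoveInvariant (ℝ ∙ w') A) : MoveInvariant (ℝ ∙ (ℝ ∙ w)ᗮ.reflection w') A := by
  intro x hx y hy hn
  obtain ⟨c, hc⟩ := mem_span_singleton.1 hy
  have h1 : (ℝ ∙ w)ᗮ.reflection y ∈ A := by
    refine h' _ (h.reflection_mem hx) _ (mem_span_singleton.2 ⟨c, ?_⟩) (by simpa using hn)
    rw [← map_sub, ← hc, map_smul, reflection_reflection]
  simpa using h.reflection_mem h1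

theorem norm_sq_add_smul_of_orthogonal {U : Submodule ℝ V} {e : V} (he : e ∈ Uᗮ) (he1 : ‖e‖ = 1)
    {u : V} (hu : u ∈ U) (h : ℝ) : ‖u + h • e‖ ^ 2 = ‖u‖ ^ 2 + h ^ 2 := by
  have h0 : inner ℝ u (h • e) = 0 := by
    rw [inner_smul_right, he u hu, mul_zero]
  rw [norm_add_sq_real, h0, norm_smul, he1]
  simp

/-- A property of squared heights which holds somewhere in `(0, 1)` and passes from `q` to all of
`[0, 4 q (1 - q)]` holds on `[0, 1]`. -/
theorem unitInterval_of_logistic {P : ℝ → Prop}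
    (hP : ∀ q, 0 < q → q < 1 → P q → ∀ q', 0 ≤ q' → q' ≤ 4 * q * (1 - q) → P q')
    {q₀ : ℝ} (h0 : 0 < q₀) (h1 : q₀ < 1) (hq₀ : P q₀) : ∀ q, 0 ≤ q → q ≤ 1 → P q := by
  suffices hh : P (1 / 2) from
    fun q hq hq' => hP (1 / 2) (by norm_num) (by norm_num) hh q hq (by linarith)
  -- For `d ≤ 1 / 2` one has `2 * d ≤ 4 * d * (1 - d)`, so `d` can be doubled until it is capped at
  -- `1 / 2`, where the logistic bound equals `1`.
  have key : ∀ m : ℕ, ∃ d, 0 < d ∧ d ≤ 1 / 2 ∧ P d ∧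
      (d = 1 / 2 ∨ 2 ^ m * (4 * q₀ * (1 - q₀)) ≤ 2 * d) := by
    intro m
    induction m with
    | zero =>
      have hp : 0 < 4 * q₀ * (1 - q₀) := by
        have : 0 < 1 - q₀ := by linarith
        positivity
      refine ⟨min (1 / 2) (4 * q₀ * (1 - q₀)), lt_min (by norm_num) hp, min_le_left _ _,
        hP q₀ h0 h1 hq₀ _ (lt_min (by norm_num) hp).le (min_le_right _ _), ?_⟩
      rcases min_choice (1 / 2) (4 * q₀ * (1 - q₀)) with h | h
      · exact Or.inl h
      · right
        rw [h]
        linarith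
    | succ m ih =>
      obtain ⟨d, hd, hd2, hPd, h⟩ := ih
      refine ⟨min (1 / 2) (2 * d), lt_min (by norm_num) (by linarith), min_le_left _ _,
        hP d hd (by linarith) hPd _ (lt_min (by norm_num) (by linarith)).le
          ((min_le_right _ _).trans (by nlinarith)), ?_⟩
      rcases min_choice (1 / 2) (2 * d) with h' | h'
      · exact Or.inl h'
      · rcases h with h | h
        · left
          rw [h]
          norm_num
        · right
          rw [h', pow_succ]
          linarith
  have hp : 0 < 4 * q₀ * (1 - q₀) := by
    have : 0 < 1 - q₀ := by linarith
    positivity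
  obtain ⟨m, hm⟩ := pow_unbounded_of_one_lt (1 / (4 * q₀ * (1 - q₀))) (one_lt_two (α := ℝ))
  obtain ⟨d, -, hd2, hPd, h | h⟩ := key m
  · exact h ▸ hPd
  · rw [div_lt_iff₀ hp] at hm
    linarith

theorem exists_orthonormal_pair {U : Submodule ℝ V} [FiniteDimensional ℝ U]
    (hU : 2 ≤ Module.finrank ℝ U) :
    ∃ f ∈ U, ∃ g ∈ U, ‖f‖ = 1 ∧ ‖g‖ = 1 ∧ inner ℝ f g = 0 := by
  have b := stdOrthonormalBasis ℝ U
  refine ⟨b ⟨0, by omega⟩, (b _).2, b ⟨1, by omega⟩, (b _).2, ?_, ?_, ?_⟩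
  · exact b.norm_eq_one _
  · exact b.norm_eq_one _
  · exact b.orthonormal.2 (by simp)

/-! ### Enlarging a subspace of reflection directions -/

/-- If the directions of a family closed under its own reflections contain a subspace `U` of
dimension at least two and a vector `v` not orthogonal to `U`, they contain `U ⊔ span v`. -/
theorem sup_span_singleton_subset_of_reflection {R : Set V}
    (hsmul : ∀ w ∈ R, ∀ c : ℝ, c • w ∈ R)
    (hrefl : ∀ w ∈ R, ∀ w' ∈ R, (ℝ ∙ w)ᗮ.reflection w' ∈ R)
    {U : Submodule ℝ V} [FiniteDimensional ℝ U] (hU : 2 ≤ Module.finrank ℝ U)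
    (hUR : (U : Set V) ⊆ R) {v : V} (hv : v ∈ R) (hvU : v ∉ Uᗮ) :
    ((U ⊔ ℝ ∙ v : Submodule ℝ V) : Set V) ⊆ R := by
  by_cases hvmem : v ∈ U
  · rwa [sup_eq_left.2 ((span_singleton_le_iff_mem _ _).2 hvmem)]
  -- `R` is itself invariant under moves along `U`. So, for unit vectors `u + h • e`, only the
  -- height `h` decides membership.
  have move : ∀ x ∈ R, ∀ y, y - x ∈ U → ‖y‖ = ‖x‖ → y ∈ R := by
    intro x hx y hy hn
    have h := hrefl (x - y) (hUR (by simpa using U.neg_mem hy)) x hx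
    rwa [reflection_sub hn.symm] at h
  set p := U.starProjection v with hp
  have hpU : p ∈ U := U.starProjection_apply_mem v
  have he0U : v - p ∈ Uᗮ := U.sub_starProjection_mem_orthogonal v
  have he0 : v - p ≠ 0 := fun h => hvmem (by rw [sub_eq_zero.1 h]; exact hpU)
  have hp0 : p ≠ 0 := fun h => hvU (by simpa [h] using he0U)
  obtain ⟨e, he⟩ : ∃ e, e = ‖v - p‖⁻¹ • (v - p) := ⟨_, rfl⟩
  have heU : e ∈ Uᗮ := he ▸ Uᗮ.smul_mem _ he0U
  have hen : 0 < ‖v - p‖ := norm_pos_iff.2 he0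
  have he1 : ‖e‖ = 1 := by
    rw [he, norm_smul, norm_inv, norm_norm, inv_mul_cancel₀ hen.ne']
  have hve : v = p + ‖v - p‖ • e := by
    rw [he, smul_smul, mul_inv_cancel₀ hen.ne', one_smul, add_sub_cancel]
  have hvn : ‖v‖ ^ 2 = ‖p‖ ^ 2 + ‖v - p‖ ^ 2 := by
    conv_lhs => rw [hve]
    exact norm_sq_add_smul_of_orthogonal heU he1 hpU _
  have hpn : 0 < ‖p‖ := norm_pos_iff.2 hp0
  have hvpos : 0 < ‖v‖ := norm_pos_iff.2 fun h => hvmem (h ▸ U.zero_mem)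
  have all : ∀ q, 0 ≤ q → q ≤ 1 → ∀ u ∈ U, ∀ h : ℝ, h ^ 2 = q → ‖u‖ ^ 2 = 1 - q →
      u + h • e ∈ R := by
    refine unitInterval_of_logistic (q₀ := (‖v - p‖ / ‖v‖) ^ 2) ?_ (by positivity) ?_ ?_
    · intro q hq0 hq1 hq q' hq'0 hq' u' hu' h' hh' hn'
      obtain ⟨f, hf, g, hg, hf1, hg1, hfg⟩ := exists_orthonormal_pair hU
      have hsq : √q ^ 2 = q := Real.sq_sqrt hq0.le
      have hsqpos : 0 < √q := Real.sqrt_pos.2 hq0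
      have hcq : √(1 - q) ^ 2 = 1 - q := Real.sq_sqrt (by linarith)
      have hcpos : 0 < √(1 - q) := Real.sqrt_pos.2 (by linarith)
      have hwR := hq (√(1 - q) • f) (U.smul_mem _ hf) (√q) hsq
        (by rw [norm_smul, hf1, mul_one, Real.norm_eq_abs, sq_abs, hcq])
      set w := √(1 - q) • f + √q • e with hw
      have hw1 : ‖w‖ = 1 := by
        have : ‖w‖ ^ 2 = 1 := by
          rw [hw, norm_sq_add_smul_of_orthogonal heU he1 (U.smul_mem _ hf), norm_smul, hf1, mul_one,
            Real.norm_eq_abs, sq_abs, hcq, hsq]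
          ring
        nlinarith [norm_nonneg w]
      -- Reflecting a unit vector of `U` with `f`-coordinate `a` by `w` gives height `-2 * a * √(1 -
      -- q) * √q`; this `a` makes it `h'`. The condition `|a| ≤ 1` is exactly `q' ≤ 4 * q * (1 -
      -- q)`, and `g` supplies the rest of the unit vector.
      obtain ⟨a, ha⟩ : ∃ a, a = -h' / (2 * √q * √(1 - q)) := ⟨_, rfl⟩
      have ha' : -2 * a * √(1 - q) * √q = h' := by
        rw [ha]
        field_simp
      have ha2 : a ^ 2 ≤ 1 := by
        rw [ha, div_pow, mul_pow, mul_pow, hsq, hcq, neg_sq, hh']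
        rw [div_le_one (mul_pos (by positivity) (by linarith))]
        linarith
      have hb : √(1 - a ^ 2) ^ 2 = 1 - a ^ 2 := Real.sq_sqrt (by linarith)
      obtain ⟨x, hx⟩ : ∃ x, x = a • f + √(1 - a ^ 2) • g := ⟨_, rfl⟩
      have hxU : x ∈ U := hx ▸ U.add_mem (U.smul_mem _ hf) (U.smul_mem _ hg)
      have hx1 : ‖x‖ ^ 2 = 1 := by
        rw [hx, norm_add_sq_real, inner_smul_left, inner_smul_right, hfg, norm_smul, norm_smul, hf1,
          hg1, mul_one, mul_one, Real.norm_eq_abs, Real.norm_eq_abs, sq_abs, sq_abs, hb]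
        simp
      have hwx : inner ℝ w x = √(1 - q) * a := by
        have h1 : inner ℝ e x = 0 := by rw [real_inner_comm]; exact heU x hxU
        rw [hw, inner_add_left, inner_smul_left, inner_smul_left, h1, hx, inner_add_right,
          inner_smul_right, inner_smul_right, hfg, real_inner_self_eq_norm_sq, hf1]
        simp
      have hr : (ℝ ∙ w)ᗮ.reflection x = (x - (2 * (√(1 - q) * a) * √(1 - q)) • f) + h' • e := by
        rw [Submodule.reflection_orthogonal_apply, reflection_singleton_apply, hwx, hw1, ← ha', hw]
        simp only [RCLike.ofReal_real_eq_id, id_eq, one_pow, div_one]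
        module
      have hrR := hrefl w hwR x (hUR hxU)
      have hrn : ‖(ℝ ∙ w)ᗮ.reflection x‖ ^ 2 = 1 := by rw [LinearIsometryEquiv.norm_map, hx1]
      rw [hr] at hrR hrn
      refine move _ hrR _ ?_ ?_
      · rw [add_sub_add_right_eq_sub]
        exact U.sub_mem hu' (U.sub_mem hxU (U.smul_mem _ hf))
      · refine (sq_eq_sq₀ (norm_nonneg _) (norm_nonneg _)).1 ?_
        rw [hrn, norm_sq_add_smul_of_orthogonal heU he1 hu', hh', hn']
        ring
    · rw [div_pow, div_lt_one (by positivity), hvn]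
      have : 0 < ‖p‖ ^ 2 := by positivity
      linarith
    · have hpos : ∀ u ∈ U, ‖u‖ ^ 2 = 1 - (‖v - p‖ / ‖v‖) ^ 2 →
          u + (‖v - p‖ / ‖v‖) • e ∈ R := by
        intro u hu hn
        have h1 : ‖v‖⁻¹ • v = ‖v‖⁻¹ • p + (‖v - p‖ / ‖v‖) • e := by
          conv_lhs => rw [hve, smul_add, smul_smul, ← hve]
          rw [div_eq_inv_mul]
        refine move _ (hsmul v hv ‖v‖⁻¹) _ ?_ ?_
        · rw [h1, add_sub_add_right_eq_sub]
          exact U.sub_mem hu (U.smul_mem _ hpU)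
        · refine (sq_eq_sq₀ (norm_nonneg _) (norm_nonneg _)).1 ?_
          rw [norm_sq_add_smul_of_orthogonal heU he1 hu, hn, norm_smul, norm_inv, norm_norm,
            inv_mul_cancel₀ hvpos.ne']
          ring
      intro u hu h hh hn
      rcases sq_eq_sq_iff_eq_or_eq_neg.1 hh with h' | h'
      · rw [h']
        exact hpos u hu hn
      · have := hsmul _ (hpos (-u) (U.neg_mem hu) (by rwa [norm_neg])) (-1)
        rw [h']
        convert this using 1
        module
  intro w hw
  obtain ⟨u, hu, z, hz, rfl⟩ := Submodule.mem_sup.1 hw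
  obtain ⟨c, rfl⟩ := mem_span_singleton.1 hz
  obtain ⟨d, hd⟩ : ∃ d, d = c * ‖v - p‖ := ⟨_, rfl⟩
  obtain ⟨u', hu'⟩ : ∃ u', u' = u + c • p := ⟨_, rfl⟩
  have hu'U : u' ∈ U := hu' ▸ U.add_mem hu (U.smul_mem _ hpU)
  have hweq : u + c • v = u' + d • e := by
    rw [hu', hd]
    conv_lhs => rw [hve]
    module
  rw [hweq]
  by_cases hw0 : u' + d • e = 0
  · rw [hw0]
    exact hUR U.zero_mem
  obtain ⟨N, hN⟩ : ∃ N, N = ‖u' + d • e‖ := ⟨_, rfl⟩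
  have hNpos : 0 < N := hN ▸ norm_pos_iff.2 hw0
  have hN2 : N ^ 2 = ‖u'‖ ^ 2 + d ^ 2 := by
    rw [hN, norm_sq_add_smul_of_orthogonal heU he1 hu'U]
  have h := hsmul _ (all ((d / N) ^ 2) (by positivity) (by
    rw [div_pow, div_le_one (by positivity), hN2]
    nlinarith [sq_nonneg ‖u'‖]) (N⁻¹ • u') (U.smul_mem _ hu'U) (d / N) rfl (by
      rw [norm_smul, norm_inv, Real.norm_eq_abs, abs_of_pos hNpos]
      field_simp
      linarith)) N
  convert h using 1
  rw [smul_add, smul_smul, smul_smul, mul_inv_cancel₀ hNpos.ne', one_smul,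
    mul_div_cancel₀ _ hNpos.ne']

/-- A set invariant under moves in the directions of a family of subspaces of dimension at least two
is a union of spheres, if the family spans and does not split orthogonally. -/
theorem moveInvariant_top_of_irreducible [FiniteDimensional ℝ V] {ι : Type*}
    {U : ι → Submodule ℝ V} (hdim : ∀ j, 2 ≤ Module.finrank ℝ (U j)) (htop : ⨆ j, U j = ⊤)
    (hirr : ∀ W : Submodule ℝ V, (∀ j, U j ≤ W ∨ U j ≤ Wᗮ) → (∀ j, U j ≤ W) ∨ ∀ j, U j ≤ Wᗮ)
    {A : Set V} (hA : ∀ j, MoveInvariant (U j) A) : MoveInvariant ⊤ A := by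
  rcases isEmpty_or_nonempty ι with hι | ⟨⟨j₀⟩⟩
  · rw [iSup_of_empty] at htop
    rw [← htop]
    intro x hx y hy _
    rw [mem_bot, sub_eq_zero] at hy
    rwa [hy]
  set S : Set (Submodule ℝ V) := {W | 2 ≤ Module.finrank ℝ W ∧ MoveInvariant W A}
  obtain ⟨W, hW⟩ : ∃ W, Maximal (· ∈ S) W := by
    obtain ⟨W, hWS, hmax⟩ := WellFounded.has_min
      (wellFounded_gt (α := Submodule ℝ V)) S ⟨U j₀, hdim j₀, hA j₀⟩
    refine ⟨W, hWS, fun W' hW' hle => ?_⟩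
    by_contra hne
    exact hmax W' hW' (lt_of_le_not_ge hle hne)
  have hmem : ∀ j, ∀ v ∈ U j, v ∉ Wᗮ → v ∈ W := by
    intro j v hv hvW
    have hsub := sup_span_singleton_subset_of_reflection
      (R := {w | MoveInvariant (ℝ ∙ w) A})
      (fun w hw c => hw.mono (span_singleton_smul_le ℝ c w))
      (fun w hw w' hw' => MoveInvariant.span_reflection hw hw') hW.prop.1
      (fun w hw => hW.prop.2.mono ((span_singleton_le_iff_mem _ _).2 hw))
      ((hA j).mono ((span_singleton_le_iff_mem _ _).2 hv)) hvW
    have hS : W ⊔ ℝ ∙ v ∈ S :=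
      ⟨hW.prop.1.trans (Submodule.finrank_mono le_sup_left),
        moveInvariant_of_span_singleton fun w hw => hsub hw⟩
    exact hW.le_of_ge hS le_sup_left (mem_sup_right (mem_span_singleton_self v))
  have hdich : ∀ j, U j ≤ W ∨ U j ≤ Wᗮ := by
    intro j
    by_cases h : U j ≤ Wᗮ
    · exact Or.inr h
    obtain ⟨v₀, hv₀, hv₀W⟩ := Set.not_subset.1 h
    refine Or.inl fun v hv => ?_
    by_cases hvW : v ∈ Wᗮ
    -- Shifting by `v₀` leaves `Wᗮ`, so maximality applies to `v + v₀` as well.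
    · have h1 := hmem j (v + v₀) ((U j).add_mem hv hv₀)
        fun h' => hv₀W ((Submodule.add_mem_iff_right _ hvW).1 h')
      exact (Submodule.add_mem_iff_left _ (hmem j v₀ hv₀ hv₀W)).1 h1
    · exact hmem j v hv hvW
  rcases hirr W hdich with h | h
  · exact hW.prop.2.mono (htop ▸ iSup_le h)
  · have h1 : Wᗮ = ⊤ := top_le_iff.1 (htop ▸ iSup_le h)
    have h2 := hW.prop.1
    rw [(Submodule.orthogonal_eq_top_iff W).1 h1, finrank_bot] at h2
    omega

/-! ### Rotations, spheres and balls -/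

/-- Two points of the same norm which differ by a vector of `U` are exchanged by a rotation that
fixes `Uᗮ`, if `U` has dimension at least two. -/
theorem exists_rotation_of_sub_mem [FiniteDimensional ℝ V] {U : Submodule ℝ V}
    (hU : 2 ≤ Module.finrank ℝ U) {x y : V} (hxy : y - x ∈ U) (hn : ‖y‖ = ‖x‖) :
    ∃ φ : V ≃ₗᵢ[ℝ] V, LinearMap.det (φ.toLinearEquiv : V →ₗ[ℝ] V) = 1 ∧ (∀ z ∈ Uᗮ, φ z = z) ∧
      φ x = y := by
  rcases eq_or_ne x y with rfl | hne
  · exact ⟨LinearIsometryEquiv.refl ℝ V, by simp, by simp, rfl⟩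
  have hfix : ∀ w ∈ U, ∀ z ∈ Uᗮ, (ℝ ∙ w)ᗮ.reflection z = z := fun w hw z hz =>
    reflection_mem_subspace_eq_self (mem_orthogonal_singleton_iff_inner_right.2 (hz w hw))
  -- The reflection swapping `x` and `y` has determinant `-1`; a second one, by some `z` in `U`
  -- orthogonal to `y`, corrects the sign and keeps `y` fixed.
  obtain ⟨z, hzU, hz0, hzy⟩ : ∃ z ∈ U, z ≠ 0 ∧ inner ℝ z y = 0 := by
    obtain ⟨f, hf, g, hg, hf1, hg1, hfg⟩ := exists_orthonormal_pair hU
    by_cases hfy : inner ℝ f y = 0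
    · exact ⟨f, hf, fun h => by simp [h] at hf1, hfy⟩
    · refine ⟨inner ℝ g y • f - inner ℝ f y • g,
        U.sub_mem (U.smul_mem _ hf) (U.smul_mem _ hg), fun h => hfy ?_, ?_⟩
      · have := congrArg (fun t => inner ℝ t g) h
        simpa [inner_sub_left, inner_smul_left, hfg, real_inner_self_eq_norm_sq, hg1] using this
      · rw [inner_sub_left, inner_smul_left, inner_smul_left]
        simp [mul_comm]
  have hdet : ∀ w : V, w ≠ 0 →
      LinearMap.det ((ℝ ∙ w)ᗮ.reflection.toLinearEquiv : V →ₗ[ℝ] V) = -1 := by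
    intro w hw
    have h := Submodule.det_reflection (ℝ ∙ w)ᗮ
    rwa [Submodule.orthogonal_orthogonal, finrank_span_singleton hw, pow_one] at h
  refine ⟨(ℝ ∙ (x - y))ᗮ.reflection.trans (ℝ ∙ z)ᗮ.reflection, ?_, ?_, ?_⟩
  · have : (((ℝ ∙ (x - y))ᗮ.reflection.trans (ℝ ∙ z)ᗮ.reflection).toLinearEquiv : V →ₗ[ℝ] V) =
        ((ℝ ∙ z)ᗮ.reflection.toLinearEquiv : V →ₗ[ℝ] V) ∘ₗ
          ((ℝ ∙ (x - y))ᗮ.reflection.toLinearEquiv : V →ₗ[ℝ] V) := rfl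
    rw [this, LinearMap.det_comp, hdet _ hz0, hdet _ (sub_ne_zero.2 hne)]
    norm_num
  · intro t ht
    rw [LinearIsometryEquiv.trans_apply, hfix _ (by simpa using U.neg_mem hxy) t ht,
      hfix z hzU t ht]
  · rw [LinearIsometryEquiv.trans_apply, reflection_sub hn.symm]
    exact reflection_mem_subspace_eq_self (mem_orthogonal_singleton_iff_inner_right.2 hzy)

theorem MoveInvariant.eq_iUnion_sphere {A : Set V} (hA : MoveInvariant ⊤ A) :
    A = ⋃ r ∈ norm '' A, sphere 0 r := by
  ext y
  simp only [Set.mem_image, Set.iUnion_exists, Set.biUnion_and', Set.iUnion_iUnion_eq_right,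
    Set.mem_iUnion, mem_sphere_zero_iff_norm, exists_prop]
  exact ⟨fun hy => ⟨y, hy, rfl⟩, fun ⟨x, hx, h⟩ => hA x hx y mem_top h⟩

theorem MoveInvariant.exists_eq_closedBall {K : Set V} (hK : MoveInvariant ⊤ K)
    (hcomp : IsCompact K) (hconv : Convex ℝ K) (hint : (interior K).Nonempty) :
    ∃ r : ℝ, 0 < r ∧ K = closedBall 0 r := by
  rcases subsingleton_or_nontrivial V with hV | hV
  · refine ⟨1, one_pos, ?_⟩
    rw [Subsingleton.eq_univ_of_nonempty (hint.mono interior_subset),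
      Subsingleton.eq_univ_of_nonempty (nonempty_closedBall.2 zero_le_one)]
  obtain ⟨x, hx, hmax⟩ := hcomp.exists_isMaxOn (hint.mono interior_subset)
    continuous_norm.continuousOn
  have hx0 : x ≠ 0 := by
    rintro rfl
    have hsub : K ⊆ {0} := fun y hy => by
      have : ‖y‖ ≤ ‖(0 : V)‖ := hmax hy
      simpa using this
    have := hint.mono (interior_mono hsub)
    rw [interior_singleton] at this
    exact this.ne_empty rfl
  have hxn : 0 < ‖x‖ := norm_pos_iff.2 hx0
  refine ⟨‖x‖, hxn, Set.Subset.antisymm (fun y hy => by simpa using hmax hy) fun y hy => ?_⟩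
  rw [mem_closedBall_zero_iff] at hy
  obtain ⟨u, hu, hyu⟩ : ∃ u, ‖u‖ = ‖x‖ ∧ y = (‖y‖ / ‖x‖) • u := by
    rcases eq_or_ne y 0 with rfl | hy0
    · exact ⟨x, rfl, by simp⟩
    · have hyn : 0 < ‖y‖ := norm_pos_iff.2 hy0
      refine ⟨(‖x‖ / ‖y‖) • y, ?_, ?_⟩
      · rw [norm_smul, norm_div, norm_norm, norm_norm, div_mul_cancel₀ _ hyn.ne']
      · rw [smul_smul, div_mul_div_cancel₀ hxn.ne', div_self hyn.ne', one_smul]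
  have hs : ‖y‖ / ‖x‖ ≤ 1 := (div_le_one hxn).2 hy
  have hs0 : 0 ≤ ‖y‖ / ‖x‖ := by positivity
  -- The point `y` lies on the segment between the antipodal points `u` and `-u` of maximal norm.
  have h := hconv (hK x hx u mem_top hu) (hK x hx (-u) mem_top (by rwa [norm_neg]))
    (a := (1 + ‖y‖ / ‖x‖) / 2) (b := (1 - ‖y‖ / ‖x‖) / 2) (by linarith) (by linarith) (by ring)
  rw [hyu]
  convert h using 1
  module

/-! ### Functions constant along moves -/

/-- The move leaves one of the two components unchanged; Pythagoras then fixes the norm of the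
other. -/
theorem norm_starProjection_eq_of_sub_mem {W : Submodule ℝ V} [W.HasOrthogonalProjection] {x y : V}
    (h : y - x ∈ W ∨ y - x ∈ Wᗮ) (hn : ‖y‖ = ‖x‖) :
    ‖W.starProjection y‖ = ‖W.starProjection x‖ := by
  rcases h with h | h
  · have h1 : Wᗮ.starProjection y = Wᗮ.starProjection x := by
      rw [← sub_eq_zero, ← map_sub, Submodule.starProjection_orthogonal_apply_eq_zero h]
    have hy := W.norm_sq_eq_add_norm_sq_starProjection y
    have hx := W.norm_sq_eq_add_norm_sq_starProjection x
    refine (sq_eq_sq₀ (norm_nonneg _) (norm_nonneg _)).1 ?_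
    rw [hn, hx, h1] at hy
    linarith
  · rw [← sub_eq_zero.1 ((map_sub W.starProjection y x).symm.trans
      (W.starProjection_apply_eq_zero_iff.2 h))]

/-- A convex continuous function, constant along moves in the directions of the `U j`, that is not
constant on the unit sphere. -/
structure MoveInvariantFunction {ι : Type*} (U : ι → Submodule ℝ V) where
  toFun : V → ℝ
  continuous : Continuous toFun
  convex : ConvexOn ℝ Set.univ toFun
  map_zero : toFun 0 = 0
  map_move : ∀ j x y, y - x ∈ U j → ‖y‖ = ‖x‖ → toFun y = toFun x
  low : V
  norm_low : ‖low‖ = 1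
  map_low : toFun low ≤ 0
  high : V
  norm_high : ‖high‖ = 1
  map_high : toFun high = 1

theorem nonempty_moveInvariantFunction_of_iSup_ne_top [FiniteDimensional ℝ V] {ι : Type*}
    {U : ι → Submodule ℝ V} (h : ⨆ j, U j ≠ ⊤) : Nonempty (MoveInvariantFunction U) := by
  obtain ⟨x, hx, hx0⟩ := Submodule.exists_mem_ne_zero_of_ne_bot
    (mt Submodule.orthogonal_eq_bot_iff.1 h)
  obtain ⟨b, hb⟩ : ∃ b, b = ‖x‖⁻¹ • x := ⟨_, rfl⟩
  have hb1 : ‖b‖ = 1 := by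
    rw [hb, norm_smul, norm_inv, norm_norm, inv_mul_cancel₀ (norm_ne_zero_iff.2 hx0)]
  have hbU : b ∈ (⨆ j, U j)ᗮ := hb ▸ Submodule.smul_mem _ _ hx
  exact ⟨{
    toFun := fun y => inner ℝ b y
    continuous := by fun_prop
    convex := (innerSL ℝ b).toLinearMap.convexOn convex_univ
    map_zero := inner_zero_right b
    map_move := fun j x y hxy _ => by
      rw [← sub_eq_zero, ← inner_sub_right, real_inner_comm]
      exact hbU _ (mem_iSup_of_mem j hxy)
    low := -b
    norm_low := by rw [norm_neg, hb1]
    map_low := by rw [inner_neg_right, real_inner_self_eq_norm_sq, hb1]; norm_num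
    high := b
    norm_high := hb1
    map_high := by rw [real_inner_self_eq_norm_sq, hb1]; norm_num }⟩

theorem Submodule.exists_mem_norm_eq_one {W : Submodule ℝ V} (hW : W ≠ ⊥) :
    ∃ x ∈ W, ‖x‖ = 1 := by
  obtain ⟨x, hx, hx0⟩ := Submodule.exists_mem_ne_zero_of_ne_bot hW
  exact ⟨‖x‖⁻¹ • x, W.smul_mem _ hx, by
    rw [norm_smul, norm_inv, norm_norm, inv_mul_cancel₀ (norm_ne_zero_iff.2 hx0)]⟩

theorem nonempty_moveInvariantFunction_of_le_or_le [FiniteDimensional ℝ V] {ι : Type*}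
    {U : ι → Submodule ℝ V} {W : Submodule ℝ V} (hW : W ≠ ⊥) (hW' : Wᗮ ≠ ⊥)
    (h : ∀ j, U j ≤ W ∨ U j ≤ Wᗮ) : Nonempty (MoveInvariantFunction U) := by
  obtain ⟨b, hbW, hb⟩ := W.exists_mem_norm_eq_one hW
  obtain ⟨a, haW, ha⟩ := Wᗮ.exists_mem_norm_eq_one hW'
  exact ⟨{
    toFun := fun y => ‖W.starProjection y‖
    continuous := by fun_prop
    convex := convexOn_univ_norm.comp_linearMap W.starProjection.toLinearMap
    map_zero := by simp
    map_move := fun j x y hxy hn =>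
      norm_starProjection_eq_of_sub_mem ((h j).imp (fun h => h hxy) (fun h => h hxy)) hn
    low := a
    norm_low := ha
    map_low := by rw [W.starProjection_apply_eq_zero_iff.2 haW, norm_zero]
    high := b
    norm_high := hb
    map_high := by rw [Submodule.starProjection_eq_self_iff.2 hbW, hb] }⟩

end Moves

/-! ### Rotations, symmetry and partitions in terms of moves -/

section Euclidean

variable {n : ℕ}

theorem IsRotationFixing.sub_mem {H : Submodule ℝ (EuclideanSpace ℝ (Fin n))}
    {φ : EuclideanSpace ℝ (Fin n) ≃ₗᵢ[ℝ] EuclideanSpace ℝ (Fin n)} (h : IsRotationFixing H φ)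
    (x : EuclideanSpace ℝ (Fin n)) : φ x - x ∈ Hᗮ := by
  intro z hz
  nth_rewrite 1 [inner_sub_right, ← h.2 z hz]
  rw [φ.inner_map_map, sub_self]

theorem MoveInvariant.image_eq_of_isRotationFixing {H : Submodule ℝ (EuclideanSpace ℝ (Fin n))}
    {F : Set (EuclideanSpace ℝ (Fin n))} (hF : MoveInvariant Hᗮ F)
    {φ : EuclideanSpace ℝ (Fin n) ≃ₗᵢ[ℝ] EuclideanSpace ℝ (Fin n)} (h : IsRotationFixing H φ) :
    φ '' F = F := by
  ext y
  constructor
  · rintro ⟨x, hx, rfl⟩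
    exact hF x hx _ (h.sub_mem x) (φ.norm_map x)
  · intro hy
    refine ⟨φ.symm y, hF y hy _ ?_ (φ.symm.norm_map y), φ.apply_symm_apply y⟩
    have := Hᗮ.neg_mem (h.sub_mem (φ.symm y))
    rwa [φ.apply_symm_apply, neg_sub] at this

theorem moveInvariant_of_rotations {H : Submodule ℝ (EuclideanSpace ℝ (Fin n))}
    (hH : 2 ≤ Module.finrank ℝ Hᗮ) {F : Set (EuclideanSpace ℝ (Fin n))}
    (hF : ∀ φ, IsRotationFixing H φ → φ '' F = F) : MoveInvariant Hᗮ F := by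
  intro x hx y hxy hn
  obtain ⟨φ, hdet, hfix, rfl⟩ := exists_rotation_of_sub_mem hH hxy hn
  rw [Submodule.orthogonal_orthogonal] at hfix
  rw [← hF φ ⟨hdet, hfix⟩]
  exact Set.mem_image_of_mem φ hx

theorem norm_eq_iff_dist_eq_of_sub_mem {H : Submodule ℝ (EuclideanSpace ℝ (Fin n))}
    {p x y : EuclideanSpace ℝ (Fin n)} (hp : p ∈ H) (hx : x - p ∈ Hᗮ) (hy : y - p ∈ Hᗮ) :
    ‖y‖ = ‖x‖ ↔ dist y p = dist x p := by
  have key : ∀ z, z - p ∈ Hᗮ → ‖z‖ ^ 2 = ‖p‖ ^ 2 + dist z p ^ 2 := fun z hz => by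
    conv_lhs => rw [← add_sub_cancel p z]
    rw [norm_add_sq_real, hz p hp, dist_eq_norm]
    ring
  rw [← sq_eq_sq₀ (norm_nonneg _) (norm_nonneg _), key x hx, key y hy, add_right_inj,
    sq_eq_sq₀ dist_nonneg dist_nonneg]

/-- Within `Hᗮ + p`, with `p ∈ H`, equal norm means equal distance to `p`; each `x` lies in the
section through its projection to `H`. -/
theorem isRotationallySymmetric_iff_moveInvariant {H : Submodule ℝ (EuclideanSpace ℝ (Fin n))}
    {X : Set (EuclideanSpace ℝ (Fin n))} :
    IsRotationallySymmetric H X ↔ MoveInvariant Hᗮ X := by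
  constructor
  · intro h x hx y hxy hn
    have hp := H.starProjection_apply_mem x
    have hxp := H.sub_starProjection_mem_orthogonal x
    have hyp : y - H.starProjection x ∈ Hᗮ := by
      simpa using Hᗮ.add_mem hxy hxp
    obtain ⟨R, -, hR⟩ := h _ hp
    have hx' : x ∈ X ∩ perpTranslate H (H.starProjection x) := ⟨hx, hxp⟩
    rw [hR, Set.mem_iUnion₂] at hx'
    obtain ⟨r, hr, hxr, -⟩ := hx'
    have hy' : y ∈ X ∩ perpTranslate H (H.starProjection x) := by
      rw [hR, Set.mem_iUnion₂]
      exact ⟨r, hr, ((norm_eq_iff_dist_eq_of_sub_mem hp hxp hyp).1 hn).trans hxr, hyp⟩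
    exact hy'.1
  · intro h p hp
    refine ⟨(dist · p) '' (X ∩ perpTranslate H p), ?_, ?_⟩
    · rintro _ ⟨x, -, rfl⟩
      exact dist_nonneg
    · ext y
      rw [Set.mem_iUnion₂]
      constructor
      · exact fun hy => ⟨dist y p, ⟨y, hy, rfl⟩, rfl, hy.2⟩
      · rintro ⟨_, ⟨x, ⟨hx, hxp⟩, rfl⟩, hy, hyp⟩
        refine ⟨h x hx y ?_ ((norm_eq_iff_dist_eq_of_sub_mem hp hxp hyp).2 hy), hyp⟩
        have := Hᗮ.sub_mem hyp hxp
        rwa [sub_sub_sub_cancel_right] at this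

theorem HasOrthogonalPartition.exists_le_or_le {ι : Type*}
    {U : ι → Submodule ℝ (EuclideanSpace ℝ (Fin n))} (hU : ∀ j, U j ≠ ⊥)
    (h : HasOrthogonalPartition (Set.range U)) :
    ∃ W : Submodule ℝ (EuclideanSpace ℝ (Fin n)), W ≠ ⊥ ∧ Wᗮ ≠ ⊥ ∧ ∀ j, U j ≤ W ∨ U j ≤ Wᗮ := by
  obtain ⟨𝒜, ℬ, ⟨A, hA⟩, ⟨B, hB⟩, -, hAB, horth⟩ := h
  have hBW : ∀ B ∈ ℬ, B ≤ (sSup 𝒜)ᗮ := fun B hB =>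
    (Submodule.isOrtho_sSup_left.2 fun A hA => horth A hA B hB).symm
  have hne : ∀ C ∈ 𝒜 ∪ ℬ, C ≠ ⊥ := by
    rw [hAB]
    rintro _ ⟨j, rfl⟩
    exact hU j
  refine ⟨sSup 𝒜, ne_bot_of_le_ne_bot (hne A (Or.inl hA)) (le_sSup hA),
    ne_bot_of_le_ne_bot (hne B (Or.inr hB)) (hBW B hB), fun j => ?_⟩
  have hj : U j ∈ 𝒜 ∪ ℬ := hAB ▸ Set.mem_range_self j
  exact hj.imp (fun h => le_sSup h) (hBW _)

theorem forall_le_or_of_not_hasOrthogonalPartition {ι : Type*}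
    {U : ι → Submodule ℝ (EuclideanSpace ℝ (Fin n))} (hU : ∀ j, U j ≠ ⊥)
    (h : ¬ HasOrthogonalPartition (Set.range U)) (W : Submodule ℝ (EuclideanSpace ℝ (Fin n)))
    (hW : ∀ j, U j ≤ W ∨ U j ≤ Wᗮ) : (∀ j, U j ≤ W) ∨ ∀ j, U j ≤ Wᗮ := by
  by_contra! hcon
  obtain ⟨⟨i, hi⟩, ⟨j, hj⟩⟩ := hcon
  refine h ⟨{C ∈ Set.range U | C ≤ W}, {C ∈ Set.range U | C ≤ Wᗮ},
    ⟨U j, ⟨j, rfl⟩, (hW j).resolve_right hj⟩, ⟨U i, ⟨i, rfl⟩, (hW i).resolve_left hi⟩, ?_, ?_, ?_⟩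
  · rw [Set.disjoint_left]
    rintro _ ⟨⟨l, rfl⟩, hl⟩ ⟨-, hl'⟩
    -- Only the zero subspace could lie in both classes.
    exact hU l (le_bot_iff.1 (W.orthogonal_disjoint hl hl'))
  · ext C
    constructor
    · rintro (hC | hC) <;> exact hC.1
    · rintro ⟨l, rfl⟩
      exact (hW l).imp (fun h => ⟨⟨l, rfl⟩, h⟩) (fun h => ⟨⟨l, rfl⟩, h⟩)
  · rintro A ⟨-, hA⟩ B ⟨-, hB⟩
    exact (Submodule.isOrtho_orthogonal_right W).mono hA hB

theorem nonempty_moveInvariantFunction {ι : Type*}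
    {U : ι → Submodule ℝ (EuclideanSpace ℝ (Fin n))} (hU : ∀ j, U j ≠ ⊥)
    (h : ¬ (⨆ j, U j = ⊤ ∧ ¬ HasOrthogonalPartition (Set.range U))) :
    Nonempty (MoveInvariantFunction U) := by
  by_cases htop : ⨆ j, U j = ⊤
  · have hp : HasOrthogonalPartition (Set.range U) := by
      by_contra hp
      exact h ⟨htop, hp⟩
    obtain ⟨W, hW, hW', hle⟩ := hp.exists_le_or_le hU
    exact nonempty_moveInvariantFunction_of_le_or_le hW hW' hle
  · exact nonempty_moveInvariantFunction_of_iSup_ne_top htop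

end Euclidean

/-! ### Counterexamples from sublevel sets -/

namespace MoveInvariantFunction

variable {V ι : Type*} [NormedAddCommGroup V] [InnerProductSpace ℝ V] {U : ι → Submodule ℝ V}

/-- The part of the unit sphere where the function is nonpositive. -/
def cap (g : MoveInvariantFunction U) : Set V := sphere 0 1 ∩ {x | g.toFun x ≤ 0}

theorem isClosed_cap (g : MoveInvariantFunction U) : IsClosed g.cap :=
  isClosed_sphere.inter (isClosed_le g.continuous continuous_const)

theorem low_mem_cap (g : MoveInvariantFunction U) : g.low ∈ g.cap :=
  ⟨mem_sphere_zero_iff_norm.2 g.norm_low, g.map_low⟩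

theorem high_notMem_cap (g : MoveInvariantFunction U) : g.high ∉ g.cap := fun h => by
  have := h.2
  rw [Set.mem_ofPred_eq, g.map_high] at this
  norm_num at this

theorem moveInvariant_cap (g : MoveInvariantFunction U) (j : ι) : MoveInvariant (U j) g.cap :=
  fun x hx y hxy hn => ⟨mem_sphere_zero_iff_norm.2 (hn.trans (mem_sphere_zero_iff_norm.1 hx.1)),
    (g.map_move j x y hxy hn).trans_le hx.2⟩

/-- The part of the unit ball where the function is at most `1 / 2`. -/
def body [FiniteDimensional ℝ V] (g : MoveInvariantFunction U) : ConvexBody V where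
  -- A level strictly between `0` and `1` keeps the origin interior and `low` inside, but excludes
  -- `high`.
  carrier := closedBall 0 1 ∩ {x | g.toFun x ≤ 1 / 2}
  convex' := (convex_closedBall 0 1).inter (by simpa using g.convex.convex_le (1 / 2))
  isCompact' := (isCompact_closedBall 0 1).inter_right (isClosed_le g.continuous continuous_const)
  nonempty' := ⟨0, by simp, by simp [g.map_zero]⟩

theorem mem_body [FiniteDimensional ℝ V] (g : MoveInvariantFunction U) {x : V} :
    x ∈ (g.body : Set V) ↔ ‖x‖ ≤ 1 ∧ g.toFun x ≤ 1 / 2 :=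
  and_congr_left' mem_closedBall_zero_iff

theorem interior_body_nonempty [FiniteDimensional ℝ V] (g : MoveInvariantFunction U) :
    (interior (g.body : Set V)).Nonempty := by
  refine ⟨0, mem_interior.2 ⟨ball 0 1 ∩ {x | g.toFun x < 1 / 2}, fun x hx => g.mem_body.2
    ⟨(mem_ball_zero_iff.1 hx.1).le, le_of_lt hx.2⟩,
    isOpen_ball.inter (isOpen_lt g.continuous continuous_const), by simp, by simp [g.map_zero]⟩⟩

theorem moveInvariant_body [FiniteDimensional ℝ V] (g : MoveInvariantFunction U) (j : ι) :
    MoveInvariant (U j) (g.body : Set V) := fun x hx y hxy hn => by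
  rw [g.mem_body] at hx ⊢
  rwa [hn, g.map_move j x y hxy hn]

theorem body_ne_closedBall [FiniteDimensional ℝ V] (g : MoveInvariantFunction U) (r : ℝ) :
    (g.body : Set V) ≠ closedBall 0 r := by
  intro h
  have hl : g.low ∈ (g.body : Set V) :=
    g.mem_body.2 ⟨g.norm_low.le, g.map_low.trans (by norm_num)⟩
  rw [h, mem_closedBall_zero_iff, g.norm_low, ← g.norm_high, ← mem_closedBall_zero_iff, ← h,
    g.mem_body, g.map_high] at hl
  norm_num at hl

end MoveInvariantFunction

theorem mainTheorem1 (n k : ℕ) (H : Fin k → Submodule ℝ (EuclideanSpace ℝ (Fin n)))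
    (hH : ∀ j, 1 ≤ Module.finrank ℝ (H j) ∧ Module.finrank ℝ (H j) + 2 ≤ n) :
    List.TFAE [
      (⨆ j, (H j)ᗮ) = ⊤ ∧ ¬ HasOrthogonalPartition (Set.range fun j => (H j)ᗮ),
      ∀ E : Set (EuclideanSpace ℝ (Fin n)), E ⊆ Metric.sphere 0 1 → E.Nonempty → IsClosed E →
        (∀ j, ∀ x ∈ E, Metric.sphere 0 1 ∩ perpTranslate (H j) x ⊆ E) →
          E = Metric.sphere 0 1,
      ∀ F : Set (EuclideanSpace ℝ (Fin n)), IsClosed F →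
        (∀ j, ∀ φ, IsRotationFixing (H j) φ → φ '' F = F) →
          ∃ R : Set ℝ, (∀ r ∈ R, 0 ≤ r) ∧ F = ⋃ r ∈ R, Metric.sphere 0 r,
      ∀ K : ConvexBody (EuclideanSpace ℝ (Fin n)),
        (interior (K : Set (EuclideanSpace ℝ (Fin n)))).Nonempty →
        (∀ j, IsRotationallySymmetric (H j) (K : Set (EuclideanSpace ℝ (Fin n)))) →
          ∃ r : ℝ, 0 < r ∧ (K : Set (EuclideanSpace ℝ (Fin n))) = Metric.closedBall 0 r] := by

  have hdim : ∀ j, 2 ≤ Module.finrank ℝ (H j)ᗮ := fun j => by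
    have h := (H j).finrank_add_finrank_orthogonal
    rw [finrank_euclideanSpace_fin] at h
    have := (hH j).2
    omega
  have hbot : ∀ j, (H j)ᗮ ≠ ⊥ := fun j h => by
    have := hdim j
    rw [h, finrank_bot] at this
    omega
  have inv (h : (⨆ j, (H j)ᗮ) = ⊤ ∧ ¬ HasOrthogonalPartition (Set.range fun j => (H j)ᗮ))
      {A : Set (EuclideanSpace ℝ (Fin n))} (hA : ∀ j, MoveInvariant (H j)ᗮ A) :
      MoveInvariant ⊤ A :=
    moveInvariant_top_of_irreducible hdim h.1
      (forall_le_or_of_not_hasOrthogonalPartition hbot h.2) hA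
  tfae_have 1 → 2 := by
    intro h E hE ⟨x, hx⟩ _ hinv
    have hm := inv h (A := E) fun j x hx y hxy hn => hinv j x hx
      ⟨mem_sphere_zero_iff_norm.2 (hn.trans (mem_sphere_zero_iff_norm.1 (hE hx))), hxy⟩
    refine hE.antisymm fun y hy => hm x hx y mem_top ?_
    rw [mem_sphere_zero_iff_norm.1 hy, mem_sphere_zero_iff_norm.1 (hE hx)]
  tfae_have 1 → 3 := by
    intro h F _ hrot
    refine ⟨norm '' F, ?_, (inv h fun j =>
      moveInvariant_of_rotations (hdim j) (hrot j)).eq_iUnion_sphere⟩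
    rintro _ ⟨x, -, rfl⟩
    exact norm_nonneg x
  tfae_have 1 → 4 := by
    intro h K hint hsymm
    exact (inv h fun j => isRotationallySymmetric_iff_moveInvariant.1
      (hsymm j)).exists_eq_closedBall K.isCompact K.convex hint
  tfae_have 2 → 1 := by
    intro h
    by_contra hn
    obtain ⟨g⟩ := nonempty_moveInvariantFunction hbot hn
    refine g.high_notMem_cap ?_
    rw [h g.cap Set.inter_subset_left ⟨_, g.low_mem_cap⟩ g.isClosed_cap fun j x hx y hy =>
      g.moveInvariant_cap j x hx y hy.2 ?_]
    · exact mem_sphere_zero_iff_norm.2 g.norm_high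
    · rw [mem_sphere_zero_iff_norm.1 hy.1, mem_sphere_zero_iff_norm.1 hx.1]
  tfae_have 3 → 1 := by
    intro h
    by_contra hn
    obtain ⟨g⟩ := nonempty_moveInvariantFunction hbot hn
    obtain ⟨R, -, hR⟩ := h g.cap g.isClosed_cap fun j φ hφ =>
      (g.moveInvariant_cap j).image_eq_of_isRotationFixing hφ
    have hl := g.low_mem_cap
    rw [hR, Set.mem_iUnion₂] at hl
    obtain ⟨r, hr, hlr⟩ := hl
    refine g.high_notMem_cap ?_
    rw [hR, Set.mem_iUnion₂]
    refine ⟨r, hr, ?_⟩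
    rw [mem_sphere_zero_iff_norm] at hlr ⊢
    rw [g.norm_high, ← hlr, g.norm_low]
  tfae_have 4 → 1 := by
    intro h
    by_contra hn
    obtain ⟨g⟩ := nonempty_moveInvariantFunction hbot hn
    obtain ⟨r, -, hr⟩ := h g.body g.interior_body_nonempty fun j =>
      isRotationallySymmetric_iff_moveInvariant.2 (g.moveInvariant_body j)
    exact g.body_ne_closedBall r hr
  tfae_finish
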